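/- Let $n\ge 0$ be an integer and let $\Omega\subset\mathbb{R}^{n+1}$ be a uniform domain, i.e. an open connected set such that, writing $\delta(x)=\operatorname{dist}(x,\partial\Omega)$, (i) (corkscrew condition) there is $c>0$ such that for every $\xi\in\partial\Omega$ and $0<r<\operatorname{diam}\partial\Omega$ there is a ball $B(x,cr)\subseteq\Omega\cap B(\xi,r)$; (ii) (Harnack chain condition) there are $C>0$ and a function $N:[1,\infty)\to\mathbb{N}$ such that for all $\rho>0$, $M\ge1$ and all $x,y\in\Omega$ with $\delta(x),\delta(y)\ge\rho$ and $|x-y|<M\rho$ there are open balls $B_1,\dots,B_m\subset\Omega$ with $m\le N(M)$, $x\in B_1$, $y\in B_m$, $B_k\cap B_{k+1}\ne\emptyset$ for $1\le k<m$, and $C^{-1}\operatorname{diam}B_k\le\operatorname{dist}(B_k,\partial\Omega)\le C\operatorname{diam}B_k$ for all $k$. Let $\Lambda\ge 1$ and let $A=(a_{ij})_{1\le i,j\le n+1}$ be a (not necessarily symmetric) real matrix-valued function on $\Omega$ with locally Lipschitz entries that is uniformly elliptic with constant $\Lambda$: for every $x\in\Omega$ and all $v,w\in\mathbb{R}^{n+1}$,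 $$\Lambda^{-1}|v|^2\le\langle A(x)v,v\rangle,\qquad \langle A(x)v,w\rangle\le\Lambda|v||w|.$$ Let $B_0$ be an open ball centered on $\partial\Omega$ such that $$\int_{B_0\cap\Omega}\delta(x)\,|\nabla a_{ij}(x)|^2\,dx<\infty\qquad\text{for all } i,j.$$ Then for $\mathcal{H}^n$-a.e. $\xi\in B_0\cap\partial\Omega$ the operator $L_A=-\operatorname{div}(A\nabla\,\cdot)$ has vanishing mean oscillation at $\xi$ with respect to $\Omega$, that is, $$\lim_{r\to0}\frac1{r^{n+1}}\inf_{C\in\mathscr{C}}\int_{B(\xi,r)\cap\Omega}|A(x)-C|\,dx=0,$$ where $\mathscr{C}$ is the set of constant real $(n+1)\times(n+1)$ matrices $C$ satisfying $\Lambda^{-1}|v|^2\le\langle Cv,v\rangle$ and $\langle Cv,w\rangle\le\Lambda|v||w|$ for all $v,w\in\mathbb{R}^{n+1}$. -/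

import Mathlib

open MeasureTheory Topology

noncomputable section

/-- The distance `inf {|x - y| : x ∈ S, y ∈ T}` between two sets. -/
def setDist {X : Type*} [PseudoEMetricSpace X] (S T : Set X) : ENNReal :=
  ⨅ x ∈ S, Metric.infEDist x T

/-- Interior corkscrew condition: every ball `B(ξ, r)` centred on the boundary with
`0 < r < diam ∂Ω` contains a ball of radius `c r` lying in `Ω`. -/
def CorkscrewCondition {d : ℕ} (Ω : Set (EuclideanSpace ℝ (Fin d))) : Prop :=
  ∃ c : ℝ, 0 < c ∧ ∀ ξ ∈ frontier Ω, ∀ r : ℝ, 0 < r →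
    ENNReal.ofReal r < Metric.ediam (frontier Ω) →
    ∃ x : EuclideanSpace ℝ (Fin d), Metric.ball x (c * r) ⊆ Ω ∩ Metric.ball ξ r

/-- There is a chain of `m` open balls `B_0, …, B_{m-1}` in `Ω` from `x` to `y`, consecutive
balls meeting, with `C⁻¹ diam B_k ≤ dist (B_k, ∂Ω) ≤ C diam B_k` for each `k`. -/
def HasHarnackChain {d : ℕ} (Ω : Set (EuclideanSpace ℝ (Fin d))) (C : ℝ) (m : ℕ)
    (x y : EuclideanSpace ℝ (Fin d)) : Prop :=
  1 ≤ m ∧ ∃ B : ℕ → Set (EuclideanSpace ℝ (Fin d)),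
    (∀ k < m, ∃ z : EuclideanSpace ℝ (Fin d), ∃ s : ℝ, 0 < s ∧ B k = Metric.ball z s) ∧
    (∀ k < m, B k ⊆ Ω) ∧
    x ∈ B 0 ∧ y ∈ B (m - 1) ∧
    (∀ k, k + 1 < m → (B k ∩ B (k + 1)).Nonempty) ∧
    (∀ k < m, Metric.ediam (B k) ≤ ENNReal.ofReal C * setDist (B k) (frontier Ω) ∧
      setDist (B k) (frontier Ω) ≤ ENNReal.ofReal C * Metric.ediam (B k))

/-- Harnack chain condition: points at distance at least `ρ` from the boundary and less than
`M ρ` from each other are joined by a Harnack chain with at most `N M` balls. -/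
def HarnackChainCondition {d : ℕ} (Ω : Set (EuclideanSpace ℝ (Fin d))) : Prop :=
  ∃ C : ℝ, 0 < C ∧ ∃ N : ℝ → ℕ, ∀ ρ : ℝ, 0 < ρ → ∀ M : ℝ, 1 ≤ M →
    ∀ x ∈ Ω, ∀ y ∈ Ω,
      ρ ≤ Metric.infDist x (frontier Ω) → ρ ≤ Metric.infDist y (frontier Ω) →
      dist x y < M * ρ → ∃ m ≤ N M, HasHarnackChain Ω C m x y

/-- A uniform domain: an open connected set with the corkscrew and Harnack chain conditions. -/
structure IsUniformDomain {d : ℕ} (Ω : Set (EuclideanSpace ℝ (Fin d))) : Prop where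
  isOpen : IsOpen Ω
  isConnected : IsConnected Ω
  corkscrew : CorkscrewCondition Ω
  harnackChain : HarnackChainCondition Ω

/-- `Λ⁻¹ |v|² ≤ ⟨M v, v⟩` and `⟨M v, w⟩ ≤ Λ |v| |w|` for all vectors `v, w`
(no symmetry of `M` is required). -/
def IsEllipticMatrix {d : ℕ} (Λ : ℝ) (M : Matrix (Fin d) (Fin d) ℝ) : Prop :=
  (∀ v : EuclideanSpace ℝ (Fin d),
    Λ⁻¹ * ‖v‖ ^ 2 ≤ inner ℝ (Matrix.toEuclideanLin M v) v) ∧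
  (∀ v w : EuclideanSpace ℝ (Fin d),
    inner ℝ (Matrix.toEuclideanLin M v) w ≤ Λ * ‖v‖ * ‖w‖)

/-- The Euclidean (Frobenius) norm of a matrix. -/
def matrixNorm {d : ℕ} (M : Matrix (Fin d) (Fin d) ℝ) : ℝ :=
  Real.sqrt (∑ i, ∑ j, M i j ^ 2)

/-- Vanishing mean oscillation of the coefficients `A` at `ξ` with respect to `Ω`:
`r^{-d} inf_C ∫_{B(ξ,r) ∩ Ω} |A(x) - C| dx → 0` as `r → 0⁺`, the infimum being over the constant
elliptic matrices `C` with ellipticity constant `Λ`. -/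
def VMOAt {d : ℕ} (Λ : ℝ) (Ω : Set (EuclideanSpace ℝ (Fin d)))
    (A : EuclideanSpace ℝ (Fin d) → Matrix (Fin d) (Fin d) ℝ)
    (ξ : EuclideanSpace ℝ (Fin d)) : Prop :=
  Filter.Tendsto
    (fun r : ℝ =>
      (⨅ C ∈ {C : Matrix (Fin d) (Fin d) ℝ | IsEllipticMatrix Λ C},
        ∫⁻ x in Metric.ball ξ r ∩ Ω, ENNReal.ofReal (matrixNorm (A x - C)))
        / ENNReal.ofReal (r ^ d))
    (𝓝[>] 0) (𝓝 0)

end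

/-! Let `μ` be the measure on `B₀ ∩ Ω` with density `δ ∑ |∇a_ij|²`. It is finite and gives no mass
to the closed set `∂Ω`, so a Vitali covering argument (`hausdorffMeasure_setOf_not_density_zero`)
yields `μ(B(ξ, r)) = o(rⁿ)` at `ℋⁿ`-almost every boundary point of `B₀`. From there the argument is
deterministic at each such `ξ`.

Split `B(ξ, r) ∩ Ω` at depth `δ = η r`. The corkscrew condition makes `∂Ω` porous, so for small `η`
the shallow part has volume at most `ε r^(n+1)` (`CorkscrewCondition.volume_thin_le`), and `A` is
bounded there. In the deep part, Harnack chains join any two points by boundedly many segments of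
length `≲ r` staying at depth `≳ r`. Integrating the gradient along slightly translated chains gives
a Poincaré-type inequality (`HarnackChainCondition.exists_oscillation_le`): for one `y ∈ Ω`, `∑ ∫
|a_ij - a_ij(y)| ≤ M r ∑ ∫ |∇a_ij|`, the right side being over a larger deep region. Since `δ ≥ σ r`
there, Young's inequality bounds `r ∫ |∇a_ij|` by `≲ τ r^(n+1) + (r / τ) μ(B(ξ, K r))`; fixing `τ`
small and then letting `r → 0` makes this negligible. The constant matrix is `C = A(y)`. -/

noncomputable section

/-! ### Gradient bounds for translates of locally Lipschitz functions -/

section Translation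

variable {E : Type*} [NormedAddCommGroup E] [NormedSpace ℝ E]

/-- Fundamental theorem of calculus inequality along a segment on which a locally Lipschitz
function is almost everywhere differentiable. -/
theorem LocallyLipschitzOn.enorm_sub_le_lintegral_fderiv {Ω : Set E} {f : E → ℝ}
    (hf : LocallyLipschitzOn Ω f) {x v : E} (hx : ∀ t ∈ Set.Icc (0 : ℝ) 1, x + t • v ∈ Ω)
    (hd : ∀ᵐ t ∂(volume.restrict (Set.Icc (0 : ℝ) 1)), DifferentiableAt ℝ f (x + t • v)) :
    ‖f (x + v) - f x‖ₑ ≤ ∫⁻ t in Set.Icc (0 : ℝ) 1, ‖v‖ₑ * ‖fderiv ℝ f (x + t • v)‖ₑ := by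
  set g : ℝ → ℝ := fun t => f (x + t • v) with hg
  have hline : LipschitzWith ‖v‖₊ (fun t : ℝ => x + t • v) := by
    refine LipschitzWith.of_dist_le_mul fun s t => ?_
    rw [dist_add_left, dist_eq_norm, ← sub_smul, norm_smul, dist_eq_norm, mul_comm]
    rfl
  have hgl : LocallyLipschitzOn (Set.Icc (0 : ℝ) 1) g := by
    intro t ht
    obtain ⟨K, u, hu, hK⟩ := hf (hx t ht)
    refine ⟨K * ‖v‖₊, (fun t : ℝ => x + t • v) ⁻¹' u, ?_, ?_⟩
    · exact (hline.continuous.continuousWithinAt (s := Set.Icc (0 : ℝ) 1)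
        |>.tendsto_nhdsWithin (fun s hs => hx s hs)) hu
    · exact hK.comp hline.lipschitzOnWith fun s hs => hs
  -- Compactness of the parameter interval upgrades local Lipschitz to Lipschitz, hence to absolute
  -- continuity.
  obtain ⟨K, hK⟩ := hgl.exists_lipschitzOnWith_of_compact isCompact_Icc
  have hac : AbsolutelyContinuousOnInterval g 0 1 := by
    refine LipschitzOnWith.absolutelyContinuousOnInterval (K := K) ?_
    rwa [Set.uIcc_of_le zero_le_one]
  have hint := hac.integral_deriv_eq_sub
  have e : f (x + v) - f x = ∫ t in Set.Ioc (0 : ℝ) 1, deriv g t := by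
    rw [← intervalIntegral.integral_of_le zero_le_one, hint]; simp [hg]
  rw [e, ← restrict_Ioc_eq_restrict_Icc]
  rw [← restrict_Ioc_eq_restrict_Icc] at hd
  refine (enorm_integral_le_lintegral_enorm _).trans (lintegral_mono_ae ?_)
  filter_upwards [hd] with t ht
  have hl : HasDerivAt (fun t : ℝ => x + t • v) v t := by
    simpa using ((hasDerivAt_id t).smul_const v).const_add x
  have h := (ht.hasFDerivAt.comp_hasDerivAt t hl).deriv
  have h' : deriv g t = fderiv ℝ f (x + t • v) v := h
  rw [h', mul_comm]
  exact ContinuousLinearMap.le_opENorm _ _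

variable [FiniteDimensional ℝ E] [MeasurableSpace E] [BorelSpace E]

/-- Rademacher's theorem for locally Lipschitz functions on an open set. -/
theorem LocallyLipschitzOn.ae_differentiableAt_of_mem {Ω : Set E} (hΩ : IsOpen Ω) {f : E → ℝ}
    (hf : LocallyLipschitzOn Ω f) (μ : Measure E) [μ.IsAddHaarMeasure] :
    μ {x | x ∈ Ω ∧ ¬ DifferentiableAt ℝ f x} = 0 := by
  refine measure_null_of_locally_null _ fun x hx => ?_
  obtain ⟨K, t, ht, hK⟩ := hf hx.1
  have ht' : t ∈ 𝓝 x := by rwa [hΩ.nhdsWithin_eq hx.1] at ht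
  obtain ⟨u, hut, huo, hxu⟩ := mem_nhds_iff.1 ht'
  refine ⟨u ∩ {x | x ∈ Ω ∧ ¬ DifferentiableAt ℝ f x},
    Filter.inter_mem (mem_nhdsWithin_of_mem_nhds (huo.mem_nhds hxu)) self_mem_nhdsWithin, ?_⟩
  have h := (hK.mono hut).ae_differentiableWithinAt_of_mem (μ := μ)
  refine measure_mono_null ?_ (ae_iff.1 h)
  rintro y ⟨hyu, -, hy⟩ h
  exact hy ((h hyu).differentiableAt (huo.mem_nhds hyu))

/-- The `L¹` norm of a difference of translates is controlled by the `L¹` norm of the gradient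
on the region swept out. -/
theorem LocallyLipschitzOn.lintegral_enorm_translate_sub_le {Ω : Set E} (hΩ : IsOpen Ω) {f : E → ℝ}
    (hf : LocallyLipschitzOn Ω f) (μ : Measure E) [μ.IsAddHaarMeasure] {S F : Set E}
    (hS : MeasurableSet S) (hF : MeasurableSet F) (hFΩ : F ⊆ Ω) (v : E)
    (h : ∀ x ∈ S, ∀ t ∈ Set.Icc (0 : ℝ) 1, x + t • v ∈ F) :
    ∫⁻ x in S, ‖f (x + v) - f x‖ₑ ∂μ ≤ ‖v‖ₑ * ∫⁻ x in F, ‖fderiv ℝ f x‖ₑ ∂μ := by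
  have hN : MeasurableSet {x | x ∈ Ω ∧ ¬ DifferentiableAt ℝ f x} :=
    hΩ.measurableSet.inter (measurableSet_of_differentiableAt ℝ f).compl
  have hN0 := hf.ae_differentiableAt_of_mem hΩ μ
  have hmeas : Measurable fun p : E × ℝ => p.1 + p.2 • v := by fun_prop
  -- By Fubini: for fixed `t` the translate of the null non-differentiability set is null, so almost
  -- every segment meets it in a null set of parameters.
  have hae : ∀ᵐ x ∂(μ.restrict S), ∀ᵐ t ∂(volume.restrict (Set.Icc (0 : ℝ) 1)),
      x + t • v ∉ {x | x ∈ Ω ∧ ¬ DifferentiableAt ℝ f x} := by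
    rw [Measure.ae_ae_comm (p := fun x (t : ℝ) =>
      x + t • v ∉ {x | x ∈ Ω ∧ ¬ DifferentiableAt ℝ f x}) (hmeas hN.compl)]
    refine Filter.Eventually.of_forall fun t => ae_restrict_of_ae ?_
    have := (measurePreserving_add_right μ (t • v)).quasiMeasurePreserving.ae
      (p := fun y => y ∉ {x | x ∈ Ω ∧ ¬ DifferentiableAt ℝ f x}) (by rw [ae_iff]; simpa using hN0)
    exact this
  have hG : Measurable fun x => ‖fderiv ℝ f x‖ₑ := (measurable_fderiv ℝ f).enorm
  calc ∫⁻ x in S, ‖f (x + v) - f x‖ₑ ∂μ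
      ≤ ∫⁻ x in S, ∫⁻ t in Set.Icc (0 : ℝ) 1, ‖v‖ₑ * ‖fderiv ℝ f (x + t • v)‖ₑ ∂volume ∂μ := by
        refine lintegral_mono_ae ?_
        filter_upwards [hae, ae_restrict_mem hS] with x hx hxS
        refine hf.enorm_sub_le_lintegral_fderiv (fun t ht => hFΩ (h x hxS t ht)) ?_
        filter_upwards [hx, ae_restrict_mem measurableSet_Icc] with t ht htI
        by_contra hc
        exact ht ⟨hFΩ (h x hxS t htI), hc⟩
    _ = ∫⁻ t in Set.Icc (0 : ℝ) 1, ∫⁻ x in S, ‖v‖ₑ * ‖fderiv ℝ f (x + t • v)‖ₑ ∂μ ∂volume := by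
        refine lintegral_lintegral_swap ?_
        exact ((hG.comp hmeas).const_mul _).aemeasurable
    _ ≤ ∫⁻ t in Set.Icc (0 : ℝ) 1, ‖v‖ₑ * ∫⁻ x in F, ‖fderiv ℝ f x‖ₑ ∂μ ∂volume := by
        refine setLIntegral_mono measurable_const fun t ht => ?_
        rw [lintegral_const_mul _ (by fun_prop)]
        refine mul_le_mul' le_rfl ?_
        rw [← lintegral_indicator hS, ← lintegral_indicator hF,
          ← lintegral_add_right_eq_self (F.indicator _) (t • v)]
        refine lintegral_mono fun x => ?_
        by_cases hx : x ∈ S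
        · simp [hx, h x hx t ht]
        · simp [hx]
    _ = ‖v‖ₑ * ∫⁻ x in F, ‖fderiv ℝ f x‖ₑ ∂μ := by simp

end Translation

/-! ### Harnack chains as polygonal paths -/

section Boundary

open Metric

/-- An open ball around a point of `Ω` not reaching `∂Ω` stays inside `Ω`. -/
theorem IsOpen.ball_subset_of_le_infDist_frontier {E : Type*} [NormedAddCommGroup E]
    [NormedSpace ℝ E] {Ω : Set E} (hΩ : IsOpen Ω) {x : E} (hx : x ∈ Ω) {r : ℝ}
    (hr : r ≤ infDist x (frontier Ω)) : ball x r ⊆ Ω := by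
  rcases le_or_gt r 0 with h0 | h0
  · simp [ball_eq_empty.2 h0]
  -- The ball is connected and meets `Ω`; leaving `Ω` would produce a boundary point at distance
  -- less than `r`.
  refine (convex_ball x r).isPreconnected.subset_of_closure_inter_subset hΩ
    ⟨x, mem_ball_self h0, hx⟩ ?_
  rintro y ⟨hyc, hy⟩
  by_contra hyΩ
  have := infDist_le_dist_of_mem (x := x) (hΩ.frontier_eq ▸ ⟨hyc, hyΩ⟩ : y ∈ frontier Ω)
  rw [mem_ball, dist_comm] at hy
  linarith

/-- If `ball x r ⊆ Ω` with `Ω` open then `∂Ω` is at distance at least `r` from `x`. -/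
theorem IsOpen.le_infDist_frontier_of_ball_subset {E : Type*} [PseudoMetricSpace E] {Ω : Set E}
    (hΩ : IsOpen Ω) (hne : (frontier Ω).Nonempty) {x : E} {r : ℝ} (h : ball x r ⊆ Ω) :
    r ≤ infDist x (frontier Ω) := by
  refine (le_infDist hne).2 fun y hy => ?_
  by_contra hlt
  rw [not_le, dist_comm] at hlt
  have hyΩ : y ∈ Ω := h hlt
  rw [hΩ.frontier_eq] at hy
  exact hy.2 hyΩ

variable {d : ℕ} {Ω : Set (EuclideanSpace ℝ (Fin d))}

/-- Two points of a ball of a Harnack chain have comparable distances to the boundary, and their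
distance is controlled by the distance to the boundary. -/
theorem harnack_ball_comparison (hne : (frontier Ω).Nonempty) {C : ℝ} (hC : 0 < C)
    {B : Set (EuclideanSpace ℝ (Fin d))}
    (hB : Metric.ediam B ≤ ENNReal.ofReal C * setDist B (frontier Ω))
    {u w : EuclideanSpace ℝ (Fin d)} (hu : u ∈ B) (hw : w ∈ B) :
    dist u w ≤ C * infDist u (frontier Ω) ∧
      infDist u (frontier Ω) ≤ (1 + C) * infDist w (frontier Ω) := by
  have key : ∀ a ∈ B, edist u w ≤ ENNReal.ofReal C * infEDist a (frontier Ω) := fun a ha =>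
    (edist_le_ediam_of_mem hu hw).trans (hB.trans (by
      gcongr
      exact iInf₂_le a ha))
  have key' : ∀ a ∈ B, dist u w ≤ C * infDist a (frontier Ω) := fun a ha => by
    have h := ENNReal.toReal_mono
      (ENNReal.mul_ne_top ENNReal.ofReal_ne_top (infEDist_ne_top hne)) (key a ha)
    rwa [ENNReal.toReal_mul, ENNReal.toReal_ofReal hC.le, ← dist_edist] at h
  refine ⟨key' u hu, ?_⟩
  have h := infDist_le_infDist_add_dist (s := frontier Ω) (x := u) (y := w)
  have h' := key' w hw
  linarith

/-- A polygonal chain in `Ω` obtained from a Harnack chain. -/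
theorem HasHarnackChain.exists_polygonal (hne : (frontier Ω).Nonempty) {C : ℝ} (hC : 0 < C)
    {m : ℕ} {x y : EuclideanSpace ℝ (Fin d)} (h : HasHarnackChain Ω C m x y)
    {ξ : EuclideanSpace ℝ (Fin d)} (hξ : ξ ∈ frontier Ω) :
    ∃ z : ℕ → EuclideanSpace ℝ (Fin d), z 0 = x ∧ z m = y ∧
      ∀ k < m, ∀ u ∈ segment ℝ (z k) (z (k + 1)), u ∈ Ω ∧
        infDist x (frontier Ω) ≤ (1 + C) ^ m * infDist u (frontier Ω) ∧
        dist u ξ ≤ (1 + C) ^ m * dist x ξ := by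
  obtain ⟨hm, B, hball, hBΩ, hxB, hyB, hinter, hdiam⟩ := h
  have hQ : 1 ≤ 1 + C := by linarith
  choose! p hp using hinter
  -- Interior vertices lie in `B (k - 1) ∩ B k`, so `z k` and `z (k + 1)` share the convex set `B
  -- k`, which contains their segment.
  let z : ℕ → EuclideanSpace ℝ (Fin d) := fun k =>
    if k = 0 then x else if k = m then y else p (k - 1)
  have hz1 : ∀ k < m, z k ∈ B k := by
    intro k hk
    rcases Nat.eq_zero_or_pos k with rfl | hk0
    · simpa [z] using hxB
    · have : z k = p (k - 1) := by simp [z, hk0.ne', hk.ne]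
      rw [this]
      have := (hp (k - 1) (by omega)).2
      rwa [Nat.sub_add_cancel hk0] at this
  have hz2 : ∀ k < m, z (k + 1) ∈ B k := by
    intro k hk
    by_cases hkm : k + 1 = m
    · have : z (k + 1) = y := by simp [z, hkm]; omega
      rw [this]
      have e : k = m - 1 := by omega
      rwa [e]
    · have : z (k + 1) = p k := by simp [z, hkm]
      rw [this]
      exact (hp k (by omega)).1
  have step : ∀ k < m, ∀ u ∈ B k, infDist (z k) (frontier Ω) ≤ (1 + C) * infDist u (frontier Ω) ∧
      dist u ξ ≤ (1 + C) * dist (z k) ξ := by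
    intro k hk u hu
    have h := harnack_ball_comparison hne hC (hdiam k hk).1 (hz1 k hk) hu
    refine ⟨h.2, ?_⟩
    -- Because `ξ ∈ ∂Ω`, a hop of length at most `C δ(z k)` multiplies the distance to `ξ` by at
    -- most `1 + C`.
    have h1 : infDist (z k) (frontier Ω) ≤ dist (z k) ξ := infDist_le_dist_of_mem hξ
    have h2 := dist_triangle_left u ξ (z k)
    nlinarith [h.1]
  have acc : ∀ k ≤ m, infDist x (frontier Ω) ≤ (1 + C) ^ k * infDist (z k) (frontier Ω) ∧
      dist (z k) ξ ≤ (1 + C) ^ k * dist x ξ := by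
    intro k
    induction k with
    | zero => intro _; simp [z]
    | succ k ih =>
      intro hk
      have h1 := ih (by omega)
      have h2 := step k (by omega) _ (hz2 k (by omega))
      constructor
      · calc _ ≤ _ := h1.1
          _ ≤ (1 + C) ^ k * ((1 + C) * infDist (z (k + 1)) (frontier Ω)) := by gcongr; exact h2.1
          _ = _ := by ring
      · calc _ ≤ _ := h2.2
          _ ≤ (1 + C) * ((1 + C) ^ k * dist x ξ) := by gcongr; exact h1.2
          _ = _ := by ring
  refine ⟨z, by simp [z], by simp only [z, if_true]; split_ifs <;> first | rfl | omega, ?_⟩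
  intro k hk u hu
  obtain ⟨c, s, -, hc⟩ := hball k hk
  have huB : u ∈ B k := by
    have hcv : Convex ℝ (B k) := hc ▸ convex_ball c s
    exact hcv.segment_subset (hz1 k hk) (hz2 k hk) hu
  have h1 := acc k hk.le
  have h2 := step k hk u huB
  have hpow : (1 + C) ^ (k + 1) ≤ (1 + C) ^ m := pow_le_pow_right₀ hQ hk
  refine ⟨hBΩ k hk huB, ?_, ?_⟩
  · calc _ ≤ _ := h1.1
      _ ≤ (1 + C) ^ k * ((1 + C) * infDist u (frontier Ω)) := by gcongr; exact h2.1
      _ = (1 + C) ^ (k + 1) * infDist u (frontier Ω) := by ring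
      _ ≤ _ := by gcongr; exact infDist_nonneg
  · calc _ ≤ _ := h2.2
      _ ≤ (1 + C) * ((1 + C) ^ k * dist x ξ) := by gcongr; exact h1.2
      _ = (1 + C) ^ (k + 1) * dist x ξ := by ring
      _ ≤ _ := by gcongr

/-- Scale-invariant form of the Harnack chain condition inside a boundary ball. -/
theorem HarnackChainCondition.exists_polygonal (h : HarnackChainCondition Ω)
    {η : ℝ} (hη : 0 < η) (hη1 : η ≤ 1) :
    ∃ N : ℕ, ∃ K : ℝ, 1 ≤ K ∧ ∃ σ : ℝ, 0 < σ ∧ σ ≤ η ∧ ∀ ξ ∈ frontier Ω, ∀ r : ℝ, 0 < r →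
      ∀ x ∈ Ω ∩ ball ξ r, ∀ y ∈ Ω ∩ ball ξ r, η * r ≤ infDist x (frontier Ω) →
      η * r ≤ infDist y (frontier Ω) →
      ∃ m ≤ N, ∃ z : ℕ → EuclideanSpace ℝ (Fin d), z 0 = x ∧ z m = y ∧
        ∀ k < m, ∀ u ∈ segment ℝ (z k) (z (k + 1)), u ∈ Ω ∧
          σ * r ≤ infDist u (frontier Ω) ∧ dist u ξ ≤ K * r := by
  obtain ⟨C, hC, N, hN⟩ := h
  have hQ : 1 ≤ 1 + C := by linarith
  -- Points of `ball ξ r` are less than `2 r = (2 / η) (η r)` apart, so `M = 2 / η`; `P` is the loss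
  -- accumulated over the longest chain.
  set P : ℝ := (1 + C) ^ N (2 / η) with hP
  have hP0 : 0 < P := by positivity
  refine ⟨N (2 / η), P, one_le_pow₀ hQ, η / P, by positivity,
    div_le_self hη.le (one_le_pow₀ hQ), ?_⟩
  intro ξ hξ r hr x hx y hy hxδ hyδ
  have hxy : dist x y < 2 / η * (η * r) := by
    have := dist_triangle_right x y ξ
    have h1 : dist x ξ < r := hx.2
    have h2 : dist y ξ < r := hy.2
    have e : 2 / η * (η * r) = 2 * r := by field_simp
    rw [e]; linarith
  obtain ⟨m, hm, hch⟩ := hN (η * r) (by positivity) (2 / η)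
    (by rw [le_div_iff₀ hη]; linarith) x hx.1 y hy.1 hxδ hyδ hxy
  obtain ⟨z, hz0, hzm, hz⟩ := hch.exists_polygonal ⟨ξ, hξ⟩ hC hξ
  refine ⟨m, hm, z, hz0, hzm, fun k hk u hu => ?_⟩
  obtain ⟨h1, h2, h3⟩ := hz k hk u hu
  have hpow : (1 + C) ^ m ≤ P := pow_le_pow_right₀ hQ hm
  refine ⟨h1, ?_, ?_⟩
  · have : η * r ≤ P * infDist u (frontier Ω) :=
      hxδ.trans (h2.trans (by gcongr; exact infDist_nonneg))
    rw [div_mul_eq_mul_div, div_le_iff₀ hP0]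
    linarith
  · refine h3.trans ?_
    have h1 : dist x ξ < r := hx.2
    gcongr

end Boundary

/-! ### Volume of thin neighbourhoods of a porous boundary -/

section Porosity

open Metric

variable {d : ℕ} {Ω : Set (EuclideanSpace ℝ (Fin d))}

theorem EuclideanSpace.volume_ball_eq_pow_mul (x : EuclideanSpace ℝ (Fin d)) {r : ℝ}
    (hr : 0 < r) :
    volume (ball x r) = ENNReal.ofReal (r ^ d) *
      volume (ball (0 : EuclideanSpace ℝ (Fin d)) 1) := by
  simpa using Measure.addHaar_ball_of_pos (volume : Measure (EuclideanSpace ℝ (Fin d))) x hr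

/-- Sets of uniformly positive density in the balls around the points of `a`. -/
theorem mul_volume_le_of_forall_density {a b : Set (EuclideanSpace ℝ (Fin d))}
    (ha : MeasurableSet a) {s : ℝ} (hs : 0 < s) {κ : ENNReal}
    (h : ∀ p ∈ a, κ * volume (ball p s) ≤ volume (ball p s ∩ b)) :
    κ * volume a ≤ volume b := by
  set V := volume (ball (0 : EuclideanSpace ℝ (Fin d)) s) with hV
  have hVx : ∀ x : EuclideanSpace ℝ (Fin d), volume (ball x s) = V := fun x =>
    Measure.addHaar_ball_center _ x s
  have hV0 : V ≠ 0 := (measure_ball_pos _ _ hs).ne'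
  have hVt : V ≠ ⊤ := measure_ball_lt_top.ne
  have hmeas : MeasurableSet {q : EuclideanSpace ℝ (Fin d) × EuclideanSpace ℝ (Fin d) |
      dist q.1 q.2 < s} := (isOpen_lt continuous_dist continuous_const).measurableSet
  have hf : Measurable fun q : EuclideanSpace ℝ (Fin d) × EuclideanSpace ℝ (Fin d) =>
      {q : EuclideanSpace ℝ (Fin d) × EuclideanSpace ℝ (Fin d) | dist q.1 q.2 < s}.indicator
        (fun _ => (1 : ENNReal)) q := measurable_const.indicator hmeas
  have e1 : ∀ (p : EuclideanSpace ℝ (Fin d)) (c : Set (EuclideanSpace ℝ (Fin d))),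
      ∫⁻ u in c, {q : EuclideanSpace ℝ (Fin d) × EuclideanSpace ℝ (Fin d) |
        dist q.1 q.2 < s}.indicator (fun _ => (1 : ENNReal)) (u, p) = volume (ball p s ∩ c) := by
    intro p c
    have : (fun u => {q : EuclideanSpace ℝ (Fin d) × EuclideanSpace ℝ (Fin d) |
        dist q.1 q.2 < s}.indicator (fun _ => (1 : ENNReal)) (u, p)) =
        (ball p s).indicator 1 := by
      ext u; simp [Set.indicator, mem_ball]
    rw [this, lintegral_indicator_one measurableSet_ball, Measure.restrict_apply measurableSet_ball]
  have e2 : ∀ (p : EuclideanSpace ℝ (Fin d)) (c : Set (EuclideanSpace ℝ (Fin d))),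
      ∫⁻ u in c, {q : EuclideanSpace ℝ (Fin d) × EuclideanSpace ℝ (Fin d) |
        dist q.1 q.2 < s}.indicator (fun _ => (1 : ENNReal)) (p, u) = volume (ball p s ∩ c) := by
    intro p c
    rw [← e1]
    simp [Set.indicator, dist_comm]
  -- Double counting, by Tonelli, of the pairs `(p, u) ∈ a × b` with `dist p u < s`.
  have key : κ * V * volume a ≤ V * volume b := by
    calc κ * V * volume a = ∫⁻ _ in a, κ * V := by simp
      _ ≤ ∫⁻ p in a, volume (ball p s ∩ b) :=
        setLIntegral_mono' ha fun p hp => by rw [← hVx p]; exact h p hp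
      _ = ∫⁻ p in a, ∫⁻ u in b, {q : EuclideanSpace ℝ (Fin d) × EuclideanSpace ℝ (Fin d) |
            dist q.1 q.2 < s}.indicator (fun _ => (1 : ENNReal)) (p, u) := by simp_rw [e2]
      _ = ∫⁻ u in b, ∫⁻ p in a, {q : EuclideanSpace ℝ (Fin d) × EuclideanSpace ℝ (Fin d) |
            dist q.1 q.2 < s}.indicator (fun _ => (1 : ENNReal)) (p, u) :=
        lintegral_lintegral_swap (hf.aemeasurable)
      _ = ∫⁻ u in b, volume (ball u s ∩ a) := by simp_rw [e1]
      _ ≤ ∫⁻ _ in b, V := lintegral_mono fun u => (measure_mono Set.inter_subset_left).trans_eq (hVx u)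
      _ = V * volume b := by simp
  rw [mul_comm κ V, mul_assoc] at key
  exact (ENNReal.mul_le_mul_iff_right hV0 hVt).1 key

/-- One step of the decay of the volume of neighbourhoods of a porous boundary. -/
theorem corkscrew_volume_step (hΩ : IsOpen Ω) {c θ : ℝ} (hc : 0 < c) (hθ : θ ≤ c / 2)
    (hθ1 : θ ≤ 1 / 2)
    {t : ℝ} (ht : 0 < t)
    (hcork : ∀ ζ ∈ frontier Ω, ∃ x, ball x (c * t) ⊆ Ω ∩ ball ζ t)
    {ξ : EuclideanSpace ℝ (Fin d)} (hξ : ξ ∈ frontier Ω) (ρ : ℝ) :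
    (1 + ENNReal.ofReal ((c / 4) ^ d)) * volume ({x | infDist x (frontier Ω) < θ * t} ∩ ball ξ ρ) ≤
      volume ({x | infDist x (frontier Ω) < t} ∩ ball ξ (ρ + 2 * t)) := by
  have hne : (frontier Ω).Nonempty := ⟨ξ, hξ⟩
  have hop : ∀ s : ℝ, IsOpen {x : EuclideanSpace ℝ (Fin d) | infDist x (frontier Ω) < s} :=
    fun s => isOpen_lt (continuous_infDist_pt _) continuous_const
  set a := {x | infDist x (frontier Ω) < θ * t} ∩ ball ξ ρ with ha
  set b := ({x | infDist x (frontier Ω) < t} ∩ ball ξ (ρ + 2 * t)) \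
    {x | infDist x (frontier Ω) < θ * t} with hb
  have hbm : MeasurableSet b :=
    ((hop _).measurableSet.inter measurableSet_ball).diff (hop _).measurableSet
  have ham : MeasurableSet a := (hop _).measurableSet.inter measurableSet_ball
  have hab : Disjoint a b := by
    rw [Set.disjoint_left]
    rintro x hx hx'
    exact hx'.2 hx.1
  have hθt : θ * t ≤ t / 2 := by nlinarith
  have hsub : a ∪ b ⊆ {x | infDist x (frontier Ω) < t} ∩ ball ξ (ρ + 2 * t) := by
    rintro x (hx | hx)
    · have h1 : infDist x (frontier Ω) < θ * t := hx.1
      refine ⟨?_, ball_subset_ball (by linarith) hx.2⟩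
      change infDist x (frontier Ω) < t
      linarith
    · exact hx.1
  -- Near each `p ∈ a` there is a corkscrew ball; its concentric half, of radius `c t / 2 = (c / 4)
  -- (2 t)`, has depth at least `c t / 2 ≥ θ t`, so it lies in the layer `b` and fills a proportion
  -- `(c / 4) ^ d` of `ball p (2 t)`.
  have key : ENNReal.ofReal ((c / 4) ^ d) * volume a ≤ volume b := by
    refine mul_volume_le_of_forall_density ham (s := 2 * t) (by linarith) fun p hp => ?_
    obtain ⟨ζ, hζ, hpζ⟩ := (infDist_lt_iff hne).1 (show infDist p (frontier Ω) < θ * t from hp.1)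
    obtain ⟨x, hx⟩ := hcork ζ hζ
    have hxs : ball x (c / 4 * (2 * t)) ⊆ ball p (2 * t) ∩ b := by
      intro u hu
      have hu' : dist u x < c / 4 * (2 * t) := hu
      have hxu : ball u (c / 2 * t) ⊆ ball x (c * t) := by
        refine ball_subset_ball' ?_
        linarith
      have hut : u ∈ Ω ∩ ball ζ t := hx (ball_subset_ball (by nlinarith) hu)
      have hd1 : dist u ζ < t := hut.2
      have hd2 : c / 2 * t ≤ infDist u (frontier Ω) :=
        hΩ.le_infDist_frontier_of_ball_subset hne (hxu.trans fun y hy => (hx hy).1)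
      have hup : dist u p < 2 * t := by
        have := dist_triangle_right u p ζ
        linarith
      refine ⟨hup, ⟨?_, ?_⟩, ?_⟩
      · exact (infDist_le_dist_of_mem hζ).trans_lt hd1
      · have h1 : dist p ξ < ρ := hp.2
        have := dist_triangle u p ξ
        change dist u ξ < ρ + 2 * t
        linarith
      · change ¬ (infDist u (frontier Ω) < θ * t)
        rw [not_lt]
        exact le_trans (by gcongr) hd2
    refine le_trans (le_of_eq ?_) (measure_mono hxs)
    rw [EuclideanSpace.volume_ball_eq_pow_mul p (by linarith),
      EuclideanSpace.volume_ball_eq_pow_mul x (by positivity), ← mul_assoc,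
      ← ENNReal.ofReal_mul (by positivity), ← mul_pow]
  calc _ = volume a + ENNReal.ofReal ((c / 4) ^ d) * volume a := by rw [add_mul, one_mul]
    _ ≤ volume a + volume b := by gcongr
    _ = volume (a ∪ b) := (measure_union hab hbm).symm
    _ ≤ _ := measure_mono hsub

/-- Under the corkscrew condition, thin neighbourhoods of the boundary occupy a small proportion
of balls centred on the boundary. -/
theorem CorkscrewCondition.volume_thin_le (hd : d ≠ 0) (hΩ : IsOpen Ω) (hcork : CorkscrewCondition Ω)
    {ε : ℝ} (hε : 0 < ε) :
    ∃ η : ℝ, 0 < η ∧ η ≤ 1 ∧ ∃ r₀ : ℝ, 0 < r₀ ∧ ∀ ξ ∈ frontier Ω, ∀ r : ℝ, 0 < r → r < r₀ →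
      volume ({x | infDist x (frontier Ω) < η * r} ∩ ball ξ r) ≤ ENNReal.ofReal (ε * r ^ d) := by
  set V := volume (ball (0 : EuclideanSpace ℝ (Fin d)) 1) with hV
  have hVt : V ≠ ⊤ := measure_ball_lt_top.ne
  -- For a one-point boundary the corkscrew condition is void, but the thin set is then contained in
  -- a ball of radius `η r`.
  rcases (frontier Ω).subsingleton_or_nontrivial with hs | hs
  · obtain ⟨η, hη0, hη1, hη⟩ : ∃ η : ℝ, 0 < η ∧ η ≤ 1 ∧ η * V.toReal ≤ ε := by
      refine ⟨min 1 (ε / (V.toReal + 1)), by positivity, min_le_left _ _, ?_⟩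
      have hVr : 0 ≤ V.toReal := ENNReal.toReal_nonneg
      calc _ ≤ ε / (V.toReal + 1) * (V.toReal + 1) := by
            gcongr
            · exact min_le_right _ _
            · linarith
        _ = ε := by field_simp
    refine ⟨η, hη0, hη1, 1, one_pos, fun ξ hξ r hr _ => ?_⟩
    have e : frontier Ω = {ξ} := hs.eq_singleton_of_mem hξ
    calc _ ≤ volume (ball ξ (η * r)) := by
          refine measure_mono fun x hx => ?_
          have h : infDist x (frontier Ω) < η * r := hx.1
          rwa [e, infDist_singleton] at h
      _ = ENNReal.ofReal ((η * r) ^ d) * ENNReal.ofReal V.toReal := by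
          rw [EuclideanSpace.volume_ball_eq_pow_mul _ (by positivity), ENNReal.ofReal_toReal hVt]
      _ ≤ _ := by
          rw [← ENNReal.ofReal_mul (by positivity), mul_pow]
          apply ENNReal.ofReal_le_ofReal
          have : η ^ d ≤ η := pow_le_of_le_one hη0.le hη1 hd
          calc η ^ d * r ^ d * V.toReal ≤ η * r ^ d * V.toReal := by gcongr
            _ = η * V.toReal * r ^ d := by ring
            _ ≤ _ := by gcongr
  · obtain ⟨c, hc, hck⟩ := hcork
    have hdiam : 0 < ediam (frontier Ω) := ediam_pos_iff.2 hs
    obtain ⟨r₀, hr₀, hr₀d⟩ : ∃ r₀ : ℝ, 0 < r₀ ∧ ENNReal.ofReal r₀ ≤ ediam (frontier Ω) := by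
      rcases eq_or_ne (ediam (frontier Ω)) ⊤ with h | h
      · exact ⟨1, one_pos, by simp [h]⟩
      · exact ⟨(ediam (frontier Ω)).toReal, ENNReal.toReal_pos hdiam.ne' h,
          (ENNReal.ofReal_toReal h).le⟩
    set θ : ℝ := min (c / 2) (1 / 2) with hθ
    have hθ0 : 0 < θ := by positivity
    have hθ1 : θ ≤ 1 / 2 := min_le_right _ _
    set κ : ℝ := (c / 4) ^ d with hκ
    have hκ0 : 0 < κ := by positivity
    -- The radii grow by `2 t (1 + θ + θ² + ⋯) ≤ 4 t`, as `θ ≤ 1 / 2`.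
    have iter : ∀ k : ℕ, ∀ t : ℝ, 0 < t → t < r₀ → ∀ ξ ∈ frontier Ω, ∀ ρ : ℝ,
        (1 + ENNReal.ofReal κ) ^ k *
          volume ({x | infDist x (frontier Ω) < θ ^ k * t} ∩ ball ξ ρ) ≤
        volume ({x | infDist x (frontier Ω) < t} ∩ ball ξ (ρ + 4 * t)) := by
      intro k
      induction k with
      | zero =>
        intro t ht _ ξ hξ ρ
        simp only [pow_zero, one_mul]
        gcongr
        linarith
      | succ k ih =>
        intro t ht htr ξ hξ ρ
        have hθt : θ * t ≤ t / 2 := by nlinarith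
        have h1 := ih (θ * t) (by positivity) (by linarith) ξ hξ ρ
        have h2 := corkscrew_volume_step hΩ hc (min_le_left _ _) hθ1 ht
          (fun ζ hζ => hck ζ hζ t ht (((ENNReal.ofReal_lt_ofReal_iff hr₀).2 htr).trans_le hr₀d))
          hξ (ρ + 2 * t)
        calc _ = (1 + ENNReal.ofReal κ) * ((1 + ENNReal.ofReal κ) ^ k *
              volume ({x | infDist x (frontier Ω) < θ ^ k * (θ * t)} ∩ ball ξ ρ)) := by
              rw [pow_succ, pow_succ, mul_comm (_ ^ k) (1 + _), mul_assoc, mul_assoc]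
          _ ≤ (1 + ENNReal.ofReal κ) *
              volume ({x | infDist x (frontier Ω) < θ * t} ∩ ball ξ (ρ + 2 * t)) := by
              gcongr
              exact h1.trans (measure_mono
                (Set.inter_subset_inter_right _ (ball_subset_ball (by linarith))))
          _ ≤ _ := h2
          _ = _ := by ring_nf
    -- The `5` is the final radius `r + 4 r` from `iter`; `k` steps beat the volume of that ball by
    -- the factor `ε`.
    obtain ⟨k, hk⟩ := pow_unbounded_of_one_lt (5 ^ d * V.toReal / ε)
      (show 1 < 1 + κ by linarith)
    refine ⟨θ ^ k, by positivity, pow_le_one₀ hθ0.le (by linarith), r₀, hr₀, fun ξ hξ r hr hrr => ?_⟩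
    have h := iter k r hr hrr ξ hξ r
    set W := volume ({x | infDist x (frontier Ω) < θ ^ k * r} ∩ ball ξ r) with hW
    have hWt : W ≠ ⊤ := ((measure_mono Set.inter_subset_right).trans_lt measure_ball_lt_top).ne
    have h' : (1 + ENNReal.ofReal κ) ^ k * W ≤ ENNReal.ofReal ((5 * r) ^ d) * V := by
      refine h.trans ?_
      rw [← EuclideanSpace.volume_ball_eq_pow_mul ξ (by positivity)]
      refine (measure_mono Set.inter_subset_right).trans_eq ?_
      congr 2; ring
    have h'' : (1 + κ) ^ k * W.toReal ≤ (5 * r) ^ d * V.toReal := by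
      have := ENNReal.toReal_mono (ENNReal.mul_ne_top ENNReal.ofReal_ne_top hVt) h'
      rwa [ENNReal.toReal_mul, ENNReal.toReal_mul, ENNReal.toReal_pow,
        ENNReal.toReal_add (by simp) (by simp), ENNReal.toReal_ofReal hκ0.le,
        ENNReal.toReal_ofReal (by positivity), ENNReal.toReal_one] at this
    rw [← ENNReal.ofReal_toReal hWt]
    apply ENNReal.ofReal_le_ofReal
    rw [div_lt_iff₀ hε] at hk
    have hpos : 0 < (1 + κ) ^ k := by positivity
    refine le_of_mul_le_mul_left (h''.trans ?_) hpos
    calc (5 * r) ^ d * V.toReal = (5 ^ d * V.toReal) * r ^ d := by rw [mul_pow]; ring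
      _ ≤ ((1 + κ) ^ k * ε) * r ^ d := by gcongr
      _ = _ := by ring

end Porosity

/-! ### Vanishing density of a finite measure on a closed null set -/

section Density

open Metric Filter

/-- A closed set which is null for a finite measure `μ` has vanishing upper `n`-density
with respect to `μ`, at `ℋⁿ`-almost every point. -/
theorem hausdorffMeasure_setOf_not_density_zero {X : Type*} [MetricSpace X]
    [SecondCountableTopology X] [MeasurableSpace X] [BorelSpace X] (n : ℕ) (μ : Measure X)
    [IsFiniteMeasure μ] {F : Set X} (hF : IsClosed F) (hμF : μ F = 0) :
    Measure.hausdorffMeasure (n : ℝ) {ξ ∈ F | ¬ ∀ l : ℝ, 0 < l → ∃ r₀ : ℝ, 0 < r₀ ∧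
      ∀ r : ℝ, 0 < r → r < r₀ → μ (ball ξ r) ≤ ENNReal.ofReal (l * r ^ n)} = 0 := by
  let T : ℕ → Set X := fun m => {ξ ∈ F | ∀ r₀ : ℝ, 0 < r₀ → ∃ r : ℝ, 0 < r ∧ r < r₀ ∧
    ENNReal.ofReal (r ^ n / (m + 1)) < μ (ball ξ r)}
  suffices h : ∀ m, Measure.hausdorffMeasure (n : ℝ) (T m) = 0 by
    refine measure_mono_null ?_ (measure_iUnion_null h)
    rintro ξ ⟨hξF, hξ⟩
    push Not at hξ
    obtain ⟨l, hl, h⟩ := hξ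
    obtain ⟨m, hm⟩ := exists_nat_one_div_lt hl
    refine Set.mem_iUnion.2 ⟨m, hξF, fun r₀ hr₀ => ?_⟩
    obtain ⟨r, hr, hrr, hlt⟩ := h r₀ hr₀
    refine ⟨r, hr, hrr, lt_of_le_of_lt (ENNReal.ofReal_le_ofReal ?_) hlt⟩
    rw [div_eq_mul_one_div, mul_comm]
    gcongr
  intro m
  -- Vitali at scale `1 / (j + 1)`: disjoint balls of large `μ`-density whose fivefold enlargements
  -- cover `T m`.
  have hcover : ∀ j : ℕ, ∃ (r : X → ℝ) (u : Set X), u ⊆ T m ∧ u.Countable ∧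
      (∀ b ∈ u, 0 < r b ∧ r b < 1 / ((j : ℝ) + 1) ∧
        ENNReal.ofReal (r b ^ n / (m + 1)) < μ (ball b (r b))) ∧
      u.PairwiseDisjoint (fun b => closedBall b (r b)) ∧
      T m ⊆ ⋃ b : u, closedBall (b : X) (5 * r b) := by
    intro j
    have hj : (0 : ℝ) < 1 / ((j : ℝ) + 1) := by positivity
    choose! r hr using fun ξ (hξ : ξ ∈ T m) => hξ.2 _ hj
    obtain ⟨u, huT, hdisj, hu⟩ := Vitali.exists_disjoint_subfamily_covering_enlargement_closedBall
      (T m) id r _ (fun a ha => (hr a ha).2.1.le) 5 (by norm_num)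
    refine ⟨r, u, huT, ?_, fun b hb => hr b (huT hb), hdisj, fun a ha => ?_⟩
    · refine hdisj.countable_of_nonempty_interior fun b hb => ?_
      exact ⟨b, ball_subset_interior_closedBall (mem_ball_self (hr b (huT hb)).1)⟩
    · obtain ⟨b, hb, hab⟩ := hu a ha
      exact Set.mem_iUnion.2 ⟨⟨b, hb⟩, hab (mem_closedBall_self (hr a ha).1.le)⟩
  choose r u huT huc hr hdisj hcov using hcover
  have : ∀ j, Countable (u j) := fun j => (huc j).to_subtype
  -- The enlarged balls have diameter at most `10 r`, and `rⁿ / (m + 1)` is below the mass of the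
  -- ball.
  set c : ENNReal := ENNReal.ofReal (10 ^ n * (m + 1)) with hc
  have hlim0 : Tendsto (fun j : ℕ => 1 / ((j : ℝ) + 1)) atTop (𝓝 0) :=
    tendsto_one_div_add_atTop_nhds_zero_nat
  have hdiam : ∀ j (b : u j), ediam (closedBall (b : X) (5 * r j b)) ≤
      ENNReal.ofReal (10 * r j b) := by
    intro j b
    refine ediam_le_of_forall_dist_le fun x hx y hy => ?_
    have := dist_triangle_right x y (b : X)
    rw [mem_closedBall] at hx hy
    linarith
  have hmain := Measure.hausdorffMeasure_le_liminf_tsum (n : ℝ) (T m) (l := atTop)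
    (fun j : ℕ => ENNReal.ofReal (10 * (1 / ((j : ℝ) + 1))))
    (by
      have := ENNReal.tendsto_ofReal (hlim0.const_mul 10)
      simpa using this)
    (fun j (b : u j) => closedBall (b : X) (5 * r j b))
    (Eventually.of_forall fun j b => (hdiam j b).trans
      (ENNReal.ofReal_le_ofReal (by have := (hr j b b.2).2.1; linarith)))
    (Eventually.of_forall hcov)
  have hsum : ∀ j, ∑' b : u j, ediam (closedBall (b : X) (5 * r j b)) ^ (n : ℝ) ≤
      c * μ (thickening (1 / ((j : ℝ) + 1)) F) := by
    intro j
    calc _ ≤ ∑' b : u j, c * μ (ball (b : X) (r j b)) := by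
          refine ENNReal.tsum_le_tsum fun b => ?_
          obtain ⟨h0, -, h2⟩ := hr j b b.2
          rw [ENNReal.rpow_natCast]
          calc _ ≤ ENNReal.ofReal (10 * r j b) ^ n := by gcongr; exact hdiam j b
            _ = c * ENNReal.ofReal (r j b ^ n / (m + 1)) := by
                rw [hc, ← ENNReal.ofReal_mul (by positivity), ← ENNReal.ofReal_pow (by positivity)]
                congr 1
                field_simp
                rw [mul_pow]
            _ ≤ _ := by gcongr
      _ = c * μ (⋃ b : u j, ball (b : X) (r j b)) := by
          rw [ENNReal.tsum_mul_left, measure_iUnion _ fun b => measurableSet_ball]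
          intro a b hab
          exact (hdisj j a.2 b.2 (fun h => hab (Subtype.ext h))).mono ball_subset_closedBall
            ball_subset_closedBall
      _ ≤ _ := by
          gcongr
          refine Set.iUnion_subset fun b x hx => ?_
          rw [mem_thickening_iff]
          exact ⟨b, (huT j b.2).1, hx.trans (hr j b b.2).2.1⟩
  -- The disjoint balls lie in shrinking neighbourhoods of `F`, whose masses tend to `μ F = 0`
  -- because `μ` is finite and `F` closed.
  have hlim : Tendsto (fun j : ℕ => c * μ (thickening (1 / ((j : ℝ) + 1)) F)) atTop (𝓝 0) := by
    have h1 : Tendsto (fun s : ℝ => μ (thickening s F)) (𝓝[>] 0) (𝓝 (μ F)) :=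
      tendsto_measure_thickening_of_isClosed ⟨1, one_pos, measure_ne_top _ _⟩ hF
    have h2 : Tendsto (fun j : ℕ => 1 / ((j : ℝ) + 1)) atTop (𝓝[>] 0) :=
      tendsto_nhdsWithin_iff.2 ⟨hlim0, Eventually.of_forall fun j =>
        show (0 : ℝ) < 1 / ((j : ℝ) + 1) by positivity⟩
    have h3 := ENNReal.Tendsto.const_mul (a := c) (h1.comp h2) (Or.inr ENNReal.ofReal_ne_top)
    rwa [hμF, mul_zero] at h3
  refine le_antisymm (hmain.trans ?_) zero_le
  rw [← hlim.liminf_eq]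
  exact liminf_le_liminf (Eventually.of_forall hsum)

end Density

/-! ### Poincaré-type estimates along chains -/

section Oscillation

open Metric

variable {E : Type*} [NormedAddCommGroup E] [NormedSpace ℝ E] [MeasurableSpace E]

/-- A weighted Young inequality for gradients away from the boundary. -/
theorem lintegral_enorm_fderiv_le_of_le_weight {f : E → ℝ} (μ : Measure E) {F : Set E}
    (hF : MeasurableSet F) {δ : E → ℝ} {s τ r : ℝ} (hs : 0 < s) (hτ : 0 < τ) (hr : 0 < r)
    (hδ : ∀ x ∈ F, s ≤ δ x) :
    ENNReal.ofReal r * ∫⁻ x in F, ‖fderiv ℝ f x‖ₑ ∂μ ≤ ENNReal.ofReal τ * μ F +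
      ENNReal.ofReal (r ^ 2 / (τ * s)) *
        ∫⁻ x in F, ENNReal.ofReal (δ x * ‖fderiv ℝ f x‖ ^ 2) ∂μ := by
  rw [← lintegral_const_mul' _ _ ENNReal.ofReal_ne_top,
    ← lintegral_const_mul' _ _ ENNReal.ofReal_ne_top, ← setLIntegral_const,
    ← lintegral_add_left measurable_const]
  refine setLIntegral_mono' hF fun x hx => ?_
  have hδx := hδ x hx
  have hδ0 : 0 ≤ δ x := hs.le.trans hδx
  rw [← ofReal_norm, ← ENNReal.ofReal_mul hr.le, ← ENNReal.ofReal_mul (by positivity),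
    ← ENNReal.ofReal_add hτ.le (by positivity)]
  apply ENNReal.ofReal_le_ofReal
  set g := ‖fderiv ℝ f x‖ with hg
  have h1 : r ^ 2 / τ * g ^ 2 ≤ r ^ 2 / (τ * s) * (δ x * g ^ 2) := by
    calc r ^ 2 / τ * g ^ 2 = r ^ 2 / (τ * s) * (s * g ^ 2) := by field_simp
      _ ≤ _ := by gcongr
  refine le_trans ?_ (add_le_add_right h1 τ)
  -- Completing the square proves `r g ≤ τ + (r g)² / τ`.
  have h2 : τ + r ^ 2 / τ * g ^ 2 - r * g = ((τ - r * g / 2) ^ 2 + 3 / 4 * (r * g) ^ 2) / τ := by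
    field_simp; ring
  have h3 : 0 ≤ ((τ - r * g / 2) ^ 2 + 3 / 4 * (r * g) ^ 2) / τ := by positivity
  linarith

variable [FiniteDimensional ℝ E] [BorelSpace E]

/-- Comparison of the averages of `f` over translates of a ball joined by a polygonal chain. -/
theorem LocallyLipschitzOn.lintegral_enorm_sub_le_of_chain {Ω : Set E} (hΩ : IsOpen Ω) {f : E → ℝ}
    (hf : LocallyLipschitzOn Ω f) (hfm : Measurable f) (μ : Measure E) [μ.IsAddHaarMeasure]
    {F : Set E} (hF : MeasurableSet F) (hFΩ : F ⊆ Ω) {s L : ℝ} {m : ℕ} {z : ℕ → E}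
    (hz : ∀ k < m, dist (z k) (z (k + 1)) ≤ L ∧
      ∀ u ∈ segment ℝ (z k) (z (k + 1)), ∀ w ∈ ball (0 : E) s, u + w ∈ F) :
    ∫⁻ w in ball (0 : E) s, ‖f (z m + w) - f (z 0 + w)‖ₑ ∂μ ≤
      m * ENNReal.ofReal L * ∫⁻ x in F, ‖fderiv ℝ f x‖ₑ ∂μ := by
  induction m with
  | zero => simp
  | succ k ih =>
    obtain ⟨hd, hseg⟩ := hz k k.lt_succ_self
    have hstep : ∫⁻ w in ball (0 : E) s, ‖f (z (k + 1) + w) - f (z k + w)‖ₑ ∂μ ≤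
        ENNReal.ofReal L * ∫⁻ x in F, ‖fderiv ℝ f x‖ₑ ∂μ := by
      have h := hf.lintegral_enorm_translate_sub_le hΩ μ (measurableSet_ball (x := z k) (ε := s))
        hF hFΩ (z (k + 1) - z k) (fun x hx t ht => by
          have := hseg (z k + t • (z (k + 1) - z k))
            (by rw [segment_eq_image']; exact ⟨t, ht, rfl⟩) (x - z k)
            (by simpa [dist_eq_norm] using hx)
          convert this using 1
          abel)
      calc _ = ∫⁻ x in ball (z k) s, ‖f (x + (z (k + 1) - z k)) - f x‖ₑ ∂μ := by
            rw [← lintegral_indicator measurableSet_ball, ← lintegral_indicator measurableSet_ball,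
              ← lintegral_add_left_eq_self ((ball (z k) s).indicator _) (z k)]
            refine lintegral_congr fun w => ?_
            have e : z k + w + (z (k + 1) - z k) = z (k + 1) + w := by abel
            simp [Set.indicator, e]
        _ ≤ _ := h
        _ ≤ _ := by
            refine mul_le_mul' ?_ le_rfl
            rw [← ofReal_norm, norm_sub_rev, ← dist_eq_norm]
            exact ENNReal.ofReal_le_ofReal hd
    calc _ ≤ ∫⁻ w in ball (0 : E) s, (‖f (z (k + 1) + w) - f (z k + w)‖ₑ +
          ‖f (z k + w) - f (z 0 + w)‖ₑ) ∂μ := by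
          refine lintegral_mono fun w => ?_
          have e : f (z (k + 1) + w) - f (z 0 + w) =
            (f (z (k + 1) + w) - f (z k + w)) + (f (z k + w) - f (z 0 + w)) := by ring
          rw [e]
          exact enorm_add_le _ _
      _ = _ := lintegral_add_left (by fun_prop) _
      _ ≤ _ := add_le_add hstep (ih fun j hj => hz j (hj.trans k.lt_succ_self))
      _ = _ := by push_cast; ring

/-- Mean oscillation of `f` over `S`, measured against the values of `f` near a point `y` that is
joined to all the points of `S` by polygonal chains. -/
theorem LocallyLipschitzOn.lintegral_lintegral_enorm_sub_le {Ω : Set E} (hΩ : IsOpen Ω) {f : E → ℝ}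
    (hf : LocallyLipschitzOn Ω f) (hfm : Measurable f) (μ : Measure E) [μ.IsAddHaarMeasure]
    {S F : Set E} (hS : MeasurableSet S) (hF : MeasurableSet F) (hFΩ : F ⊆ Ω) {y : E} {s L : ℝ}
    {N : ℕ} (hSF : ∀ x ∈ S, ∀ w ∈ ball (0 : E) s, x + w ∈ F)
    (hchain : ∀ x ∈ S, ∃ m ≤ N, ∃ z : ℕ → E, z 0 = x ∧ z m = y ∧
      ∀ k < m, dist (z k) (z (k + 1)) ≤ L ∧
        ∀ u ∈ segment ℝ (z k) (z (k + 1)), ∀ w ∈ ball (0 : E) s, u + w ∈ F) :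
    ∫⁻ w in ball (0 : E) s, ∫⁻ x in S, ‖f x - f (y + w)‖ₑ ∂μ ∂μ ≤
      (ENNReal.ofReal s * μ (ball (0 : E) s) + N * ENNReal.ofReal L * μ S) *
        ∫⁻ x in F, ‖fderiv ℝ f x‖ₑ ∂μ := by
  set I := ∫⁻ x in F, ‖fderiv ℝ f x‖ₑ ∂μ with hI
  -- The passage from `f x` to `f (y + w)` goes through `f (x + w)`: a short move averaged over `x`
  -- here, then the chain from `x` to `y` in `h2`. The bound in `h2` is uniform in `x`, so the
  -- chains need not depend measurably on `x`.
  have h1 : ∫⁻ x in S, ∫⁻ w in ball (0 : E) s, ‖f (x + w) - f x‖ₑ ∂μ ∂μ ≤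
      ENNReal.ofReal s * μ (ball (0 : E) s) * I := by
    calc _ = ∫⁻ w in ball (0 : E) s, ∫⁻ x in S, ‖f (x + w) - f x‖ₑ ∂μ ∂μ :=
          lintegral_lintegral_swap (by fun_prop)
      _ ≤ ∫⁻ _ in ball (0 : E) s, ENNReal.ofReal s * I ∂μ := by
          refine setLIntegral_mono' measurableSet_ball fun w hw => ?_
          refine (hf.lintegral_enorm_translate_sub_le hΩ μ hS hF hFΩ w fun x hx t ht => ?_).trans ?_
          · refine hSF x hx _ ?_
            rw [mem_ball_zero_iff, norm_smul, Real.norm_of_nonneg ht.1] at *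
            nlinarith [norm_nonneg w, ht.1, ht.2]
          · refine mul_le_mul' ?_ le_rfl
            rw [← ofReal_norm]
            exact ENNReal.ofReal_le_ofReal (mem_ball_zero_iff.1 hw).le
      _ = _ := by rw [setLIntegral_const]; ring
  have h2 : ∀ x ∈ S, ∫⁻ w in ball (0 : E) s, ‖f (y + w) - f (x + w)‖ₑ ∂μ ≤
      N * ENNReal.ofReal L * I := by
    intro x hx
    obtain ⟨m, hm, z, rfl, rfl, hz⟩ := hchain x hx
    refine (hf.lintegral_enorm_sub_le_of_chain hΩ hfm μ hF hFΩ hz).trans ?_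
    gcongr
  calc _ = ∫⁻ x in S, ∫⁻ w in ball (0 : E) s, ‖f x - f (y + w)‖ₑ ∂μ ∂μ :=
        lintegral_lintegral_swap (by fun_prop)
    _ ≤ ∫⁻ x in S, ((∫⁻ w in ball (0 : E) s, ‖f (x + w) - f x‖ₑ ∂μ) +
          ∫⁻ w in ball (0 : E) s, ‖f (y + w) - f (x + w)‖ₑ ∂μ) ∂μ := by
        refine lintegral_mono fun x => ?_
        rw [← lintegral_add_left (by fun_prop)]
        refine lintegral_mono fun w => ?_
        have e : f x - f (y + w) = -((f (x + w) - f x) + (f (y + w) - f (x + w))) := by ring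
        rw [e, enorm_neg]
        exact enorm_add_le _ _
    _ ≤ ∫⁻ x in S, ((∫⁻ w in ball (0 : E) s, ‖f (x + w) - f x‖ₑ ∂μ) +
          N * ENNReal.ofReal L * I) ∂μ := by
        refine setLIntegral_mono' hS fun x hx => ?_
        gcongr
        exact h2 x hx
    _ = (∫⁻ x in S, ∫⁻ w in ball (0 : E) s, ‖f (x + w) - f x‖ₑ ∂μ ∂μ) +
          N * ENNReal.ofReal L * I * μ S := by
        rw [lintegral_add_right _ measurable_const, setLIntegral_const]
    _ ≤ ENNReal.ofReal s * μ (ball (0 : E) s) * I + N * ENNReal.ofReal L * I * μ S := by gcongr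
    _ = _ := by ring

end Oscillation

/-! ### Oscillation and gradients in the deep part of a boundary ball -/

section UniformDomain

open Metric

variable {d : ℕ} {Ω : Set (EuclideanSpace ℝ (Fin d))}

/-- The part of `Ω` in a ball lying at distance at least `t` from the boundary. -/
def deepPart (Ω : Set (EuclideanSpace ℝ (Fin d))) (ξ : EuclideanSpace ℝ (Fin d)) (ρ t : ℝ) :
    Set (EuclideanSpace ℝ (Fin d)) :=
  {x ∈ Ω ∩ ball ξ ρ | t ≤ infDist x (frontier Ω)}

theorem measurableSet_deepPart (hΩ : IsOpen Ω) (ξ : EuclideanSpace ℝ (Fin d)) (ρ t : ℝ) :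
    MeasurableSet (deepPart Ω ξ ρ t) :=
  (hΩ.measurableSet.inter measurableSet_ball).inter
    (isClosed_le continuous_const (continuous_infDist_pt _)).measurableSet

/-- In a domain with Harnack chains, the oscillation of locally Lipschitz functions over the deep
part of a boundary ball is controlled by the integral of their gradients. -/
theorem HarnackChainCondition.exists_oscillation_le (hΩ : IsOpen Ω) (h : HarnackChainCondition Ω)
    {η : ℝ} (hη : 0 < η) (hη1 : η ≤ 1) :
    ∃ M : ℝ, 0 < M ∧ ∃ K : ℝ, 0 < K ∧ ∃ σ : ℝ, 0 < σ ∧ ∀ ξ ∈ frontier Ω, ∀ r : ℝ, 0 < r →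
      (deepPart Ω ξ r (η * r)).Nonempty →
      ∀ (ι : Type) [Fintype ι] (f : ι → EuclideanSpace ℝ (Fin d) → ℝ),
      (∀ i, LocallyLipschitzOn Ω (f i)) → (∀ i, Measurable (f i)) →
      ∃ y ∈ Ω, ∑ i, ∫⁻ x in deepPart Ω ξ r (η * r), ‖f i x - f i y‖ₑ ≤
        ENNReal.ofReal (M * r) *
          ∑ i, ∫⁻ x in deepPart Ω ξ (K * r) (σ * r), ‖fderiv ℝ (f i) x‖ₑ := by
  obtain ⟨N, K, hK, σ, hσ, hση, hch⟩ := h.exists_polygonal hη hη1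
  -- Translating chains by less than `s = σ r / 2` keeps depth `σ r / 2` and stays in `ball ξ ((K +
  -- σ) r)`. The factor `(2 / σ) ^ d` is the volume ratio of `ball ξ r` to a ball of radius `s`.
  refine ⟨σ / 2 + N * (2 * K) * (2 / σ) ^ d, by positivity, K + σ, by positivity, σ / 2,
    by positivity, ?_⟩
  intro ξ hξ r hr hne ι _ f hf hfm
  have hfr : (frontier Ω).Nonempty := ⟨ξ, hξ⟩
  obtain ⟨y, hy⟩ := hne
  set S := deepPart Ω ξ r (η * r) with hS
  set F := deepPart Ω ξ ((K + σ) * r) (σ / 2 * r) with hF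
  set s : ℝ := σ / 2 * r with hs
  have hs0 : 0 < s := by positivity
  have hmove : ∀ u ∈ Ω, σ * r ≤ infDist u (frontier Ω) → dist u ξ ≤ K * r →
      ∀ w ∈ ball (0 : EuclideanSpace ℝ (Fin d)) s, u + w ∈ F := by
    intro u hu hδ hd w hw
    have hw' : dist (u + w) u < s := by simpa using hw
    have hss : s ≤ σ * r := by rw [hs]; nlinarith [mul_pos hσ hr]
    refine ⟨⟨hΩ.ball_subset_of_le_infDist_frontier hu hδ (hw'.trans_le hss), ?_⟩, ?_⟩
    · have := dist_triangle (u + w) u ξ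
      rw [mem_ball]
      linarith
    · have h1 := infDist_le_infDist_add_dist (s := frontier Ω) (x := u) (y := u + w)
      rw [dist_comm] at h1
      rw [hs] at hw'
      linarith
  have hSF : ∀ x ∈ S, ∀ w ∈ ball (0 : EuclideanSpace ℝ (Fin d)) s, x + w ∈ F := by
    intro x hx
    have hd : dist x ξ < r := hx.1.2
    exact hmove x hx.1.1 (le_trans (by gcongr) hx.2) (by nlinarith)
  have hchain : ∀ x ∈ S, ∃ m ≤ N, ∃ z : ℕ → EuclideanSpace ℝ (Fin d), z 0 = x ∧ z m = y ∧
      ∀ k < m, dist (z k) (z (k + 1)) ≤ 2 * K * r ∧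
        ∀ u ∈ segment ℝ (z k) (z (k + 1)), ∀ w ∈ ball (0 : EuclideanSpace ℝ (Fin d)) s,
          u + w ∈ F := by
    intro x hx
    obtain ⟨m, hm, z, h0, h1, hz⟩ := hch ξ hξ r hr x hx.1 y hy.1 hx.2 hy.2
    refine ⟨m, hm, z, h0, h1, fun k hk => ⟨?_, fun u hu => ?_⟩⟩
    · have h2 := (hz k hk _ (left_mem_segment ℝ _ _)).2.2
      have h3 := (hz k hk _ (right_mem_segment ℝ _ _)).2.2
      have := dist_triangle_right (z k) (z (k + 1)) ξ
      linarith
    · obtain ⟨h2, h3, h4⟩ := hz k hk u hu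
      exact hmove u h2 h3 h4
  have hSm : MeasurableSet S := measurableSet_deepPart hΩ _ _ _
  have hFm : MeasurableSet F := measurableSet_deepPart hΩ _ _ _
  have hFΩ : F ⊆ Ω := fun x hx => hx.1.1
  set I : ι → ENNReal := fun i => ∫⁻ x in F, ‖fderiv ℝ (f i) x‖ₑ with hI
  set B := volume (ball (0 : EuclideanSpace ℝ (Fin d)) s) with hB
  have hB0 : B ≠ 0 := (measure_ball_pos _ _ hs0).ne'
  have hBt : B ≠ ⊤ := measure_ball_lt_top.ne
  have hSB : volume S ≤ ENNReal.ofReal ((2 / σ) ^ d) * B := by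
    calc volume S ≤ volume (ball ξ r) := measure_mono fun x hx => hx.1.2
      _ = _ := by
        rw [hB, EuclideanSpace.volume_ball_eq_pow_mul _ hr,
          EuclideanSpace.volume_ball_eq_pow_mul _ hs0, ← mul_assoc,
          ← ENNReal.ofReal_mul (by positivity), ← mul_pow]
        congr 3
        rw [hs]; field_simp
  have hmeas : ∀ i, Measurable fun w => ∫⁻ x in S, ‖f i x - f i (y + w)‖ₑ := fun i =>
    Measurable.lintegral_prod_right' (f := fun p : _ × _ => ‖f i p.2 - f i (y + p.1)‖ₑ)
      (by have := hfm i; fun_prop)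
  -- Averaging the sum over `i`, rather than each term, gives one point `y + w` serving all the
  -- functions at once.
  obtain ⟨w, hw, hwle⟩ := exists_le_setLAverage (μ := volume)
    (s := ball (0 : EuclideanSpace ℝ (Fin d)) s)
    (f := fun w => ∑ i, ∫⁻ x in S, ‖f i x - f i (y + w)‖ₑ) hB0 hBt
    (Finset.measurable_sum _ fun i _ => hmeas i).aemeasurable
  refine ⟨y + w, hFΩ (hSF y hy w hw), hwle.trans ?_⟩
  rw [setLAverage_eq]
  refine ENNReal.div_le_of_le_mul ?_
  rw [lintegral_finsetSum _ fun i _ => hmeas i, Finset.mul_sum, Finset.sum_mul]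
  refine Finset.sum_le_sum fun i _ => ?_
  refine ((hf i).lintegral_lintegral_enorm_sub_le hΩ (hfm i) volume hSm hFm hFΩ hSF hchain).trans ?_
  calc _ ≤ (ENNReal.ofReal s * B + N * ENNReal.ofReal (2 * K * r) *
          (ENNReal.ofReal ((2 / σ) ^ d) * B)) * I i := by gcongr
    _ = (ENNReal.ofReal s + N * ENNReal.ofReal (2 * K * r) * ENNReal.ofReal ((2 / σ) ^ d)) *
          I i * B := by ring
    _ = _ := by
        congr 2
        rw [← ENNReal.ofReal_natCast, ← ENNReal.ofReal_mul (by positivity),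
          ← ENNReal.ofReal_mul (by positivity), ← ENNReal.ofReal_add hs0.le (by positivity)]
        congr 1
        rw [hs]; ring

/-- At a boundary point where the weighted gradient energy has vanishing `n`-density, the gradient
integrals over the deep parts of the boundary balls are negligible. -/
theorem eventually_lintegral_fderiv_deepPart_le {n : ℕ}
    {Ω : Set (EuclideanSpace ℝ (Fin (n + 1)))} (hΩ : IsOpen Ω)
    {f : EuclideanSpace ℝ (Fin (n + 1)) → ℝ} {ξ : EuclideanSpace ℝ (Fin (n + 1))}
    (hξ : ∀ l : ℝ, 0 < l → ∃ r₀ : ℝ, 0 < r₀ ∧ ∀ r : ℝ, 0 < r → r < r₀ →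
      ∫⁻ x in ball ξ r ∩ Ω, ENNReal.ofReal (infDist x (frontier Ω) * ‖fderiv ℝ f x‖ ^ 2) ≤
        ENNReal.ofReal (l * r ^ n))
    {M K σ ε : ℝ} (hM : 0 < M) (hK : 0 < K) (hσ : 0 < σ) (hε : 0 < ε) :
    ∃ r₀ : ℝ, 0 < r₀ ∧ ∀ r : ℝ, 0 < r → r < r₀ →
      ENNReal.ofReal (M * r) * ∫⁻ x in deepPart Ω ξ (K * r) (σ * r), ‖fderiv ℝ f x‖ₑ ≤
        ENNReal.ofReal (ε * r ^ (n + 1)) := by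
  set V := volume (ball (0 : EuclideanSpace ℝ (Fin (n + 1))) 1) with hV
  have hVt : V ≠ ⊤ := measure_ball_lt_top.ne
  have hV0 : 0 < V.toReal := ENNReal.toReal_pos (measure_ball_pos _ _ one_pos).ne' hVt
  -- `τ` and `l` make each of the two Young terms, multiplied by `M`, equal to `ε / 2 * r ^ (n +
  -- 1)`.
  set τ : ℝ := ε / (2 * (M * (K ^ (n + 1) * V.toReal))) with hτ
  have hτ0 : 0 < τ := by positivity
  set l : ℝ := ε * (τ * σ) / (2 * (M * K ^ n)) with hl
  have hl0 : 0 < l := by positivity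
  obtain ⟨r₁, hr₁, h⟩ := hξ l hl0
  refine ⟨r₁ / K, by positivity, fun r hr hrr => ?_⟩
  have hKr : 0 < K * r := by positivity
  have hKr1 : K * r < r₁ := by rwa [lt_div_iff₀ hK, mul_comm] at hrr
  have hyoung := lintegral_enorm_fderiv_le_of_le_weight (f := f)
    (volume : Measure (EuclideanSpace ℝ (Fin (n + 1))))
    (measurableSet_deepPart hΩ ξ (K * r) (σ * r)) (δ := fun x => infDist x (frontier Ω))
    (s := σ * r) (by positivity) hτ0 hr (fun x hx => hx.2)
  have h1 : volume (deepPart Ω ξ (K * r) (σ * r)) ≤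
      ENNReal.ofReal ((K * r) ^ (n + 1) * V.toReal) := by
    rw [ENNReal.ofReal_mul (by positivity), ENNReal.ofReal_toReal hVt,
      ← EuclideanSpace.volume_ball_eq_pow_mul ξ hKr]
    exact measure_mono fun x hx => hx.1.2
  have h2 : ∫⁻ x in deepPart Ω ξ (K * r) (σ * r),
      ENNReal.ofReal (infDist x (frontier Ω) * ‖fderiv ℝ f x‖ ^ 2) ≤
      ENNReal.ofReal (l * (K * r) ^ n) :=
    (lintegral_mono_set fun _ hx => And.intro hx.1.2 hx.1.1).trans (h _ hKr hKr1)
  rw [ENNReal.ofReal_mul hM.le, mul_assoc]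
  calc _ ≤ ENNReal.ofReal M * (ENNReal.ofReal τ * ENNReal.ofReal ((K * r) ^ (n + 1) * V.toReal) +
        ENNReal.ofReal (r ^ 2 / (τ * (σ * r))) * ENNReal.ofReal (l * (K * r) ^ n)) := by
        gcongr
        refine hyoung.trans ?_
        gcongr
    _ = ENNReal.ofReal (ε * r ^ (n + 1)) := by
        rw [← ENNReal.ofReal_mul hτ0.le, ← ENNReal.ofReal_mul (by positivity),
          ← ENNReal.ofReal_add (by positivity) (by positivity), ← ENNReal.ofReal_mul hM.le]
        congr 1
        have e1 : M * (τ * ((K * r) ^ (n + 1) * V.toReal)) = ε / 2 * r ^ (n + 1) := by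
          rw [hτ, mul_pow]; field_simp
        have e2 : M * (r ^ 2 / (τ * (σ * r)) * (l * (K * r) ^ n)) = ε / 2 * r ^ (n + 1) := by
          rw [hl, mul_pow]; field_simp; ring
        rw [mul_add, e1, e2]; ring

end UniformDomain

/-! ### Entrywise bounds for matrices -/

section Matrix

variable {d : ℕ}

/-- The entries of an elliptic matrix are bounded by the ellipticity constant. -/
theorem IsEllipticMatrix.abs_apply_le {Λ : ℝ} {M : Matrix (Fin d) (Fin d) ℝ}
    (h : IsEllipticMatrix Λ M) (i j : Fin d) : |M i j| ≤ Λ := by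
  -- Testing against `c = 1` and `c = -1` turns the one-sided upper bound into a bound on the
  -- absolute value.
  have e : ∀ c : ℝ, inner ℝ (Matrix.toEuclideanLin M (EuclideanSpace.single j 1))
      (EuclideanSpace.single i c) = c * M i j := fun c => by
    rw [EuclideanSpace.inner_single_right]
    simp [Matrix.toLpLin_apply]
  refine abs_le.2 ⟨?_, ?_⟩
  · have := h.2 (EuclideanSpace.single j 1) (EuclideanSpace.single i (-1))
    rw [e] at this
    simp at this
    linarith
  · have := h.2 (EuclideanSpace.single j 1) (EuclideanSpace.single i 1)
    rw [e] at this
    simpa using this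

theorem matrixNorm_le_sum_abs (M : Matrix (Fin d) (Fin d) ℝ) :
    matrixNorm M ≤ ∑ p : Fin d × Fin d, |M p.1 p.2| := by
  refine Real.sqrt_le_iff.2 ⟨Finset.sum_nonneg fun _ _ => abs_nonneg _, ?_⟩
  rw [← Fintype.sum_prod_type' (fun i j => M i j ^ 2)]
  simp_rw [← sq_abs (M _ _)]
  exact Finset.sum_sq_le_sq_sum_of_nonneg fun _ _ => abs_nonneg _

theorem ofReal_matrixNorm_le_sum_enorm (M : Matrix (Fin d) (Fin d) ℝ) :
    ENNReal.ofReal (matrixNorm M) ≤ ∑ p : Fin d × Fin d, ‖M p.1 p.2‖ₑ := by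
  refine (ENNReal.ofReal_le_ofReal (matrixNorm_le_sum_abs M)).trans_eq ?_
  rw [ENNReal.ofReal_sum_of_nonneg fun _ _ => abs_nonneg _]
  simp [Real.enorm_eq_ofReal_abs]

end Matrix

/-! ### From vanishing energy density to vanishing mean oscillation -/

section VMO

open Metric

/-- Vanishing mean oscillation at a boundary point where the weighted gradient energy of the
coefficients has vanishing `n`-density. -/
theorem IsUniformDomain.vmoAt_of_density_zero {n : ℕ} {Ω : Set (EuclideanSpace ℝ (Fin (n + 1)))}
    (hΩ : IsUniformDomain Ω)
    {A : EuclideanSpace ℝ (Fin (n + 1)) → Matrix (Fin (n + 1)) (Fin (n + 1)) ℝ}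
    {Λ : ℝ} (hΛ : 0 ≤ Λ) (hA : ∀ x ∈ Ω, IsEllipticMatrix Λ (A x))
    (hLip : ∀ i j, LocallyLipschitzOn Ω (fun x => A x i j))
    {ξ : EuclideanSpace ℝ (Fin (n + 1))} (hξ : ξ ∈ frontier Ω)
    (hdens : ∀ i j, ∀ l : ℝ, 0 < l → ∃ r₀ : ℝ, 0 < r₀ ∧ ∀ r : ℝ, 0 < r → r < r₀ →
      ∫⁻ x in ball ξ r ∩ Ω, ENNReal.ofReal (infDist x (frontier Ω) *
        ‖gradient (fun y => A y i j) x‖ ^ 2) ≤ ENNReal.ofReal (l * r ^ n)) :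
    VMOAt Λ Ω A ξ := by
  have hΩo := hΩ.isOpen
  -- Extension by zero makes the entries globally measurable; as `Ω` is open, derivatives on `Ω` do
  -- not change.
  let f : Fin (n + 1) × Fin (n + 1) → EuclideanSpace ℝ (Fin (n + 1)) → ℝ := fun p =>
    Ω.indicator fun x => A x p.1 p.2
  have hfA : ∀ p, ∀ x ∈ Ω, f p x = A x p.1 p.2 := fun p x hx => Set.indicator_of_mem hx _
  have hfL : ∀ p, LocallyLipschitzOn Ω (f p) := by
    intro p x hx
    obtain ⟨K, t, ht, hK⟩ := hLip p.1 p.2 hx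
    refine ⟨K, t ∩ Ω, Filter.inter_mem ht self_mem_nhdsWithin, fun a ha b hb => ?_⟩
    rw [hfA p a ha.2, hfA p b hb.2]
    exact hK ha.1 hb.1
  have hfm : ∀ p, Measurable (f p) := by
    intro p
    refine measurable_of_restrict_of_restrict_compl hΩo.measurableSet ?_ ?_
    · exact (continuousOn_iff_continuous_domRestrict.1 (hfL p).continuousOn).measurable
    · have : Ωᶜ.domRestrict (f p) = fun _ => 0 := by
        funext x
        exact Set.indicator_of_notMem x.2 (fun x => A x p.1 p.2)
      rw [this]
      exact measurable_const
  have hfg : ∀ p, ∀ x ∈ Ω, ‖gradient (fun y => A y p.1 p.2) x‖ = ‖fderiv ℝ (f p) x‖ := by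
    intro p x hx
    have e : f p =ᶠ[𝓝 x] fun y => A y p.1 p.2 := by
      filter_upwards [hΩo.mem_nhds hx] with y hy using hfA p y hy
    rw [e.fderiv_eq, gradient, LinearIsometryEquiv.norm_map]
  have hdens' : ∀ p, ∀ l : ℝ, 0 < l → ∃ r₀ : ℝ, 0 < r₀ ∧ ∀ r : ℝ, 0 < r → r < r₀ →
      ∫⁻ x in ball ξ r ∩ Ω, ENNReal.ofReal (infDist x (frontier Ω) * ‖fderiv ℝ (f p) x‖ ^ 2) ≤
        ENNReal.ofReal (l * r ^ n) := by
    intro p l hl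
    obtain ⟨r₀, hr₀, h⟩ := hdens p.1 p.2 l hl
    refine ⟨r₀, hr₀, fun r hr hrr => ?_⟩
    refine le_of_eq_of_le (setLIntegral_congr_fun
      (measurableSet_ball.inter hΩo.measurableSet) fun x hx => ?_) (h r hr hrr)
    simp only [hfg p x hx.2]
  set D : ℝ := (Fintype.card (Fin (n + 1) × Fin (n + 1)) : ℝ) with hD
  have hD0 : 0 < D := by rw [hD]; exact_mod_cast Fintype.card_pos
  refine ENNReal.tendsto_nhds_zero.2 fun e he => ?_
  obtain ⟨e', he'0, he'⟩ := ENNReal.lt_iff_exists_nnreal_btwn.1 he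
  have he'pos : (0 : ℝ) < e' := by exact_mod_cast he'0
  -- The deep part will cost `D ε r ^ (n + 1)` and the shallow part `2 Λ D ε r ^ (n + 1)`.
  set ε : ℝ := e' / (D * (1 + 2 * Λ)) with hε
  have hε0 : 0 < ε := by positivity
  obtain ⟨η, hη0, hη1, r₁, hr₁, hthin⟩ := hΩ.corkscrew.volume_thin_le n.succ_ne_zero hΩo hε0
  obtain ⟨M, hM, K, hK, σ, hσ, hosc⟩ := hΩ.harnackChain.exists_oscillation_le hΩo hη0 hη1
  choose r₂ hr₂ hgrad using fun p =>
    eventually_lintegral_fderiv_deepPart_le hΩo (hdens' p) hM hK hσ hε0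
  have hev : ∀ᶠ r in 𝓝[>] (0 : ℝ), 0 < r ∧ r < r₁ ∧ ∀ p, r < r₂ p := by
    refine Filter.Eventually.and self_mem_nhdsWithin (Filter.Eventually.and ?_ ?_)
    · exact mem_nhdsWithin_of_mem_nhds (Iio_mem_nhds hr₁)
    · exact Filter.eventually_all.2 fun p => mem_nhdsWithin_of_mem_nhds (Iio_mem_nhds (hr₂ p))
  filter_upwards [hev] with r ⟨hr, hrr₁, hrr₂⟩
  set S := deepPart Ω ξ r (η * r) with hS
  have hSm : MeasurableSet S := measurableSet_deepPart hΩo _ _ _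
  have hSsub : S ⊆ ball ξ r ∩ Ω := fun x hx => ⟨hx.1.2, hx.1.1⟩
  obtain ⟨y, hyΩ, hy⟩ : ∃ y ∈ Ω, ∑ p, ∫⁻ x in S, ‖f p x - f p y‖ₑ ≤
      ENNReal.ofReal (D * (ε * r ^ (n + 1))) := by
    -- The oscillation estimate needs a base point in the deep part; if that part is empty, any
    -- point of `Ω` serves.
    rcases S.eq_empty_or_nonempty with hemp | hne
    · obtain ⟨y, hy⟩ := hΩ.isConnected.nonempty
      exact ⟨y, hy, by simp [hemp]⟩
    · obtain ⟨y, hy, hle⟩ := hosc ξ hξ r hr hne _ f hfL hfm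
      refine ⟨y, hy, hle.trans ?_⟩
      rw [Finset.mul_sum]
      refine (Finset.sum_le_sum fun p _ => hgrad p r hr (hrr₂ p)).trans_eq ?_
      rw [Finset.sum_const, nsmul_eq_mul, ENNReal.ofReal_mul hD0.le, hD, ENNReal.ofReal_natCast]
      rfl
  have hdeep : ∫⁻ x in S, ENNReal.ofReal (matrixNorm (A x - A y)) ≤
      ENNReal.ofReal (D * (ε * r ^ (n + 1))) := by
    refine le_trans ?_ hy
    rw [← lintegral_finsetSum _ fun p _ => by have := hfm p; fun_prop]
    refine setLIntegral_mono' hSm fun x hx => ?_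
    refine (ofReal_matrixNorm_le_sum_enorm _).trans_eq (Finset.sum_congr rfl fun p _ => ?_)
    rw [hfA p x hx.1.1, hfA p y hyΩ, Matrix.sub_apply]
  have hshallow : ∫⁻ x in (ball ξ r ∩ Ω) \ S, ENNReal.ofReal (matrixNorm (A x - A y)) ≤
      ENNReal.ofReal (D * (2 * Λ)) * ENNReal.ofReal (ε * r ^ (n + 1)) := by
    calc _ ≤ ∫⁻ _ in (ball ξ r ∩ Ω) \ S, ENNReal.ofReal (D * (2 * Λ)) := by
          refine setLIntegral_mono' ((measurableSet_ball.inter hΩo.measurableSet).diff hSm)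
            fun x hx => ENNReal.ofReal_le_ofReal ?_
          refine (matrixNorm_le_sum_abs _).trans ?_
          refine (Finset.sum_le_card_nsmul _ _ (2 * Λ) fun p _ => ?_).trans_eq ?_
          · rw [Matrix.sub_apply]
            have h1 := (hA x hx.1.2).abs_apply_le p.1 p.2
            have h2 := (hA y hyΩ).abs_apply_le p.1 p.2
            have := abs_sub (A x p.1 p.2) (A y p.1 p.2)
            linarith
          · rw [nsmul_eq_mul]; rfl
      _ = ENNReal.ofReal (D * (2 * Λ)) * volume ((ball ξ r ∩ Ω) \ S) := setLIntegral_const _ _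
      _ ≤ _ := by
          gcongr
          refine (measure_mono ?_).trans (hthin ξ hξ r hr hrr₁)
          rintro x ⟨⟨hxr, hxΩ⟩, hxS⟩
          refine ⟨?_, hxr⟩
          by_contra hc
          exact hxS ⟨⟨hxΩ, hxr⟩, not_lt.1 hc⟩
  have htot : ∫⁻ x in ball ξ r ∩ Ω, ENNReal.ofReal (matrixNorm (A x - A y)) ≤
      e' * ENNReal.ofReal (r ^ (n + 1)) := by
    have hu : ball ξ r ∩ Ω = S ∪ (ball ξ r ∩ Ω) \ S := (Set.union_sdiff_cancel hSsub).symm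
    calc _ ≤ (∫⁻ x in S, ENNReal.ofReal (matrixNorm (A x - A y))) +
          ∫⁻ x in (ball ξ r ∩ Ω) \ S, ENNReal.ofReal (matrixNorm (A x - A y)) := by
          conv_lhs => rw [hu]
          exact lintegral_union_le _ _ _
      _ ≤ _ := add_le_add hdeep hshallow
      _ = ENNReal.ofReal e' * ENNReal.ofReal (r ^ (n + 1)) := by
          rw [← ENNReal.ofReal_mul (by positivity), ← ENNReal.ofReal_add (by positivity)
            (by positivity), ← ENNReal.ofReal_mul he'pos.le]
          congr 1
          rw [hε]; field_simp
      _ = _ := by rw [ENNReal.ofReal_coe_nnreal]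
  refine le_trans ?_ he'.le
  refine ENNReal.div_le_of_le_mul (le_trans ?_ htot)
  -- `A y` is an admissible competitor because `y ∈ Ω`.
  exact iInf₂_le (A y) (hA y hyΩ)

end VMO

end

/-- One measure carries the energies of all entries together, so a single exceptional set from the
density lemma suffices. -/
theorem mainTheorem7 (n : ℕ) (Ω : Set (EuclideanSpace ℝ (Fin (n + 1))))
    (hΩ : IsUniformDomain Ω)
    (A : EuclideanSpace ℝ (Fin (n + 1)) → Matrix (Fin (n + 1)) (Fin (n + 1)) ℝ)
    (Λ : ℝ) (hΛ : 1 ≤ Λ)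
    (hA : ∀ x ∈ Ω, IsEllipticMatrix Λ (A x))
    (hLip : ∀ i j, LocallyLipschitzOn Ω (fun x => A x i j))
    (x₀ : EuclideanSpace ℝ (Fin (n + 1))) (hx₀ : x₀ ∈ frontier Ω)
    (R : ℝ) (hR : 0 < R)
    (hint : ∀ i j, ∫⁻ x in Metric.ball x₀ R ∩ Ω,
      ENNReal.ofReal (Metric.infDist x (frontier Ω) * ‖gradient (fun y => A y i j) x‖ ^ 2) < ⊤) :
    Measure.hausdorffMeasure (n : ℝ)
      {ξ ∈ Metric.ball x₀ R ∩ frontier Ω | ¬ VMOAt Λ Ω A ξ} = 0 := by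
  have hΩo := hΩ.isOpen
  let g : Fin (n + 1) → Fin (n + 1) → EuclideanSpace ℝ (Fin (n + 1)) → ENNReal := fun i j x =>
    ENNReal.ofReal (Metric.infDist x (frontier Ω) * ‖gradient (fun y => A y i j) x‖ ^ 2)
  have hgm : ∀ i j, Measurable (g i j) := by
    intro i j
    have h1 : Measurable (gradient fun y => A y i j) :=
      (InnerProductSpace.toDual ℝ _).symm.continuous.measurable.comp (measurable_fderiv ℝ _)
    exact ((Metric.continuous_infDist_pt _).measurable.mul (h1.norm.pow_const 2)).ennreal_ofReal
  set μ : Measure (EuclideanSpace ℝ (Fin (n + 1))) :=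
    (volume.restrict (Metric.ball x₀ R ∩ Ω)).withDensity (fun x => ∑ i, ∑ j, g i j x) with hμ
  have hfin : IsFiniteMeasure μ := by
    refine isFiniteMeasure_withDensity (ne_of_lt ?_)
    rw [lintegral_finsetSum _ fun i _ => Finset.measurable_sum _ fun j _ => hgm i j]
    refine ENNReal.sum_lt_top.2 fun i _ => ?_
    rw [lintegral_finsetSum _ fun j _ => hgm i j]
    exact ENNReal.sum_lt_top.2 fun j _ => hint i j
  have hnull : μ (frontier Ω) = 0 := by
    refine withDensity_absolutelyContinuous _ _ ?_
    rw [Measure.restrict_apply isClosed_frontier.measurableSet]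
    have : frontier Ω ∩ (Metric.ball x₀ R ∩ Ω) = ∅ := by
      refine Set.eq_empty_of_forall_notMem fun x hx => ?_
      have := hx.1
      rw [hΩo.frontier_eq] at this
      exact this.2 hx.2.2
    rw [this, measure_empty]
  refine measure_mono_null ?_
    (hausdorffMeasure_setOf_not_density_zero n μ isClosed_frontier hnull)
  rintro ξ ⟨⟨hξR, hξ⟩, hvmo⟩
  refine ⟨hξ, fun hdens => hvmo ?_⟩
  refine hΩ.vmoAt_of_density_zero (zero_le_one.trans hΛ) hA hLip hξ fun i j l hl => ?_
  obtain ⟨r₀, hr₀, h⟩ := hdens l hl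
  -- Below the scale `r₁` the balls around `ξ` lie in `ball x₀ R`, so the restriction in `μ` loses
  -- nothing.
  obtain ⟨r₁, hr₁, hsub⟩ := Metric.isOpen_iff.1 Metric.isOpen_ball ξ hξR
  refine ⟨min r₀ r₁, lt_min hr₀ hr₁, fun r hr hrr => ?_⟩
  refine le_trans ?_ (h r hr (hrr.trans_le (min_le_left _ _)))
  rw [hμ, withDensity_apply _ measurableSet_ball, Measure.restrict_restrict measurableSet_ball]
  have hball : Metric.ball ξ r ⊆ Metric.ball x₀ R :=
    (Metric.ball_subset_ball (hrr.le.trans (min_le_right _ _))).trans hsub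
  refine (lintegral_mono_set fun x hx => (⟨hx.1, hball hx.1, hx.2⟩ :
    x ∈ Metric.ball ξ r ∩ (Metric.ball x₀ R ∩ Ω))).trans (lintegral_mono fun x => ?_)
  exact (Finset.single_le_sum (f := fun j => g i j x) (fun _ _ => zero_le)
    (Finset.mem_univ j)).trans
    (Finset.single_le_sum (f := fun i => ∑ j, g i j x) (fun _ _ => zero_le) (Finset.mem_univ i))
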